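/- **Conventions.** Let $[n]$ be a set of $n$ participants. A scheme maps a uniformly distributed secret $S$ in a finite set with at least two elements, by a randomized encoder, to a vector of shares $C=(C_1,\dots,C_n)$ over a finite alphabet; $C_A$ denotes the shares of the participants in $A$, and $H$ is Shannon entropy. The scheme is *perfect* for the access structure $\mathcal A_s\subseteq 2^{[n]}$ if $\mathcal A_s$ is closed under supersets, $H(S\mid C_A)=0$ for all $A\in\mathcal A_s$, and $H(S\mid C_B)=H(S)$ for all $B\notin\mathcal A_s$. It has *locality* $r$ if for every $i\in[n]$ there is $\mathcal R_i\subseteq[n]\setminus\{i\}$ with $|\mathcal R_i|\le r$ and $H(C_i\mid C_{\mathcal R_i})=0$. Let $(r+1)\mid n$ and let $\{\mathcal Q_j\}$, $1\le j\le n/(r+1)$, be a partition of $[n]$ into sets of size $r+1$. A linear code $\mathcal C\subseteq\mathbb F_q^n$ of dimension $\kappa$ is a *maximally recoverable* $(n,\kappa,r,\{\mathcal Q_j\})$ LRC if for every $j$ and $i\in\mathcal Q_j$ the symbol $i$ of a codeword is determined by the symbols in $\mathcal Q_j\setminus\{i\}$, the minimum distance of $\mathcal C$ is $n-\kappa-\lceil\kappa/r\rceil+2$,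 and puncturing $\mathcal C$ at any set consisting of one coordinate from each $\mathcal Q_j$ gives an MDS code. **Proposition.** Let $r\ge 1$. (1) There are an $n$ and a non-empty access structure $\mathcal A_s\subseteq 2^{[n]}$ with $r<\min_{A\in\mathcal A_s}|A|$ for which there is a perfect secret sharing scheme with locality $r$. (2) More precisely, let $r\mid\kappa$, $(r+1)\mid n$, $r<\kappa\le nr/(r+1)$, let $\{\mathcal Q_j\}$ be a partition of $[n]$ into sets of size $r+1$, and let $$\mathcal A_s=\Big\{A\subseteq[n]:\ \sum_{j=1}^{n/(r+1)}\min(|A\cap\mathcal Q_j|,r)\ge\kappa\Big\}.$$ Then: (a) $\mathcal A_s$ is non-empty and $r<\min_{A\in\mathcal A_s}|A|$. (b) Over some finite field $\mathbb F_q$ there is a maximally recoverable $(n,\kappa,r,\{\mathcal Q_j\})$ LRC, and some extension $\mathbb F_{q^N}$ with $N\ge n$ contains $\kappa$ elements that are linearly independent over $\mathbb F_q$. (c) For every finite field $\mathbb F_q$, every maximally recoverable $(n,\kappa,r,\{\mathcal Q_j\})$ LRC over $\mathbb F_q$ with generator matrix $G\in\mathbb F_q^{n\times\kappa}$ (whose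 columns are a basis of the code), and all $\alpha_1,\dots,\alpha_\kappa$ in a finite extension $\mathbb F_{q^N}$ that are linearly independent over $\mathbb F_q$, the following scheme is perfect for $\mathcal A_s$ and has locality $r$. The secret is $s\in\mathbb F_{q^N}$; draw $\rho\in\mathbb F_{q^N}^{\kappa-1}$ uniformly, put $a=(s,\rho_1,\dots,\rho_{\kappa-1})$ and $\Psi_a(y)=\sum_{i=1}^{\kappa}a_i\,y^{q^{i-1}}$ (Gabidulin precoding), and let the vector of shares be $G\,(\Psi_a(\alpha_1),\dots,\Psi_a(\alpha_\kappa))^{T}\in\mathbb F_{q^N}^n$. -/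

import Mathlib

noncomputable section

/-! ### Shannon entropy of finitely valued random variables -/

/-- The Shannon entropy `H(X)` (in nats) of a random variable `X` with finitely many values,
defined on the discrete probability space `(Ω, p)`. -/
def shannonEntropy {Ω β : Type*} [Fintype β] (p : PMF Ω) (X : Ω → β) : ℝ :=
  ∑ b, Real.negMulLog ((p.map X) b).toReal

/-- The conditional Shannon entropy `H(X | Y) = ∑ y, P(Y = y) H(X | Y = y)` (in nats);
here `P(X = x | Y = y) = P(X = x, Y = y) / P(Y = y)`. -/
def condShannonEntropy {Ω β γ : Type*} [Fintype β] [Fintype γ]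
    (p : PMF Ω) (X : Ω → β) (Y : Ω → γ) : ℝ :=
  ∑ y, ((p.map Y) y).toReal *
    ∑ x, Real.negMulLog (((p.map (fun ω => (X ω, Y ω))) (x, y)).toReal / ((p.map Y) y).toReal)

/-! ### Secret sharing schemes with `n` participants -/

section SecretSharing

variable {n : ℕ} {S T : Type*} [Fintype S] [Nonempty S] [Fintype T]

/-- The joint law of the secret and of the vector of shares, for a uniformly distributed secret
and the randomized encoder `f`. -/
def jointLaw (f : S → PMF (Fin n → T)) : PMF (S × (Fin n → T)) :=
  (PMF.uniformOfFintype S).bind fun s => (f s).map (Prod.mk s)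

/-- The secret, as a random variable. -/
def secretVar (ω : S × (Fin n → T)) : S := ω.1

/-- The share of participant `i`, as a random variable. -/
def shareVar (i : Fin n) (ω : S × (Fin n → T)) : T := ω.2 i

/-- The shares of the participants in `A`, as a random variable. -/
def sharesVar (A : Finset (Fin n)) (ω : S × (Fin n → T)) : A → T := fun i => ω.2 i

/-- `f` is a perfect secret sharing scheme with access structure `𝒜`: the access structure is
monotone, the sets in `𝒜` determine the secret, and every other set has no information on it. -/
structure IsPerfectScheme (f : S → PMF (Fin n → T)) (𝒜 : Set (Finset (Fin n))) : Prop where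
  monotone : ∀ A ∈ 𝒜, ∀ A', A ⊆ A' → A' ∈ 𝒜
  recovery : ∀ A ∈ 𝒜, condShannonEntropy (jointLaw f) secretVar (sharesVar A) = 0
  security : ∀ B ∉ 𝒜, condShannonEntropy (jointLaw f) secretVar (sharesVar B) =
    shannonEntropy (jointLaw f) secretVar

/-- Each share is determined by at most `r` other shares. -/
def SchemeHasLocality (f : S → PMF (Fin n → T)) (r : ℕ) : Prop :=
  ∀ i : Fin n, ∃ R : Finset (Fin n), i ∉ R ∧ R.card ≤ r ∧
    condShannonEntropy (jointLaw f) (shareVar i) (sharesVar R) = 0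

end SecretSharing

/-! ### Linear codes -/

section Codes

variable {F ι : Type*} [Field F] [Fintype ι]

open Classical in
/-- The minimum Hamming distance between two distinct codewords. -/
def codeMinDist (C : Submodule F (ι → F)) : ℕ :=
  sInf {d | ∃ u ∈ C, ∃ v ∈ C, u ≠ v ∧ hammingDist u v = d}

/-- A maximum distance separable code: its minimum distance is `length - dimension + 1`. -/
def IsMDSCode (C : Submodule F (ι → F)) : Prop :=
  codeMinDist C + Module.finrank F C = Fintype.card ι + 1

/-- The code `C` punctured at the coordinates in `D`: the coordinates outside `D` are kept. -/
def puncturedCode {n : ℕ} (C : Submodule F (Fin n → F)) (D : Finset (Fin n)) :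
    Submodule F ({i : Fin n // i ∉ D} → F) :=
  C.map (LinearMap.funLeft F F Subtype.val)

/-- `R` is a recovery set of the coordinate `i` for the code `C`. -/
def IsRecoverySet {n : ℕ} (C : Submodule F (Fin n → F)) (i : Fin n) (R : Finset (Fin n)) : Prop :=
  i ∉ R ∧ ∀ u ∈ C, ∀ v ∈ C, u i ≠ v i → ∃ j ∈ R, u j ≠ v j

/-- A linear `(n, k, r)`-optimal locally repairable code: its dimension is `k`, it has
locality `r`, and its minimum distance is `n - k - ⌈k / r⌉ + 2`. -/
structure IsOptimalLRC {n : ℕ} (C : Submodule F (Fin n → F)) (k r : ℕ) : Prop where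
  finrank_eq : Module.finrank F C = k
  locality : ∀ i, ∃ R, R.card ≤ r ∧ IsRecoverySet C i R
  minDist_eq : codeMinDist C + k + k ⌈/⌉ r = n + 2

/-- The sets `Q j` are a partition of the `n` coordinates into sets of size `r + 1`. -/
structure IsRepairPartition {n : ℕ} (r : ℕ) (Q : Fin (n / (r + 1)) → Finset (Fin n)) : Prop where
  card_eq : ∀ j, (Q j).card = r + 1
  existsUnique_mem : ∀ i, ∃! j, i ∈ Q j

/-- A linear maximally recoverable `(n, k, r, {Q j})` locally repairable code: an optimal one in
which coordinate `i ∈ Q j` has the recovery set `Q j \ {i}`, and such that puncturing any one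
coordinate from each `Q j` gives an MDS code. -/
structure IsMaximallyRecoverable {n : ℕ} (C : Submodule F (Fin n → F)) (k r : ℕ)
    (Q : Fin (n / (r + 1)) → Finset (Fin n)) : Prop where
  optimal : IsOptimalLRC C k r
  partition : IsRepairPartition r Q
  recovery : ∀ j, ∀ i ∈ Q j, IsRecoverySet C i ((Q j).erase i)
  mds : ∀ D : Finset (Fin n), (∀ j, (D ∩ Q j).card = 1) → IsMDSCode (puncturedCode C D)

/-- `G` is a generator matrix of `C`: codewords are `G a`, and the columns of `G` form a basis
of `C`. -/
def IsGeneratorMatrix {n k : ℕ} (G : Matrix (Fin n) (Fin k) F) (C : Submodule F (Fin n → F)) :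
    Prop :=
  LinearIndependent F G.col ∧ LinearMap.range G.mulVecLin = C

end Codes

/-! ### Gabidulin precoding -/

section Gabidulin

variable (F : Type*) {K : Type*} [Field F] [Fintype F] [Field K] [Algebra F K]

/-- The linearized polynomial `∑ i, a i * y ^ (q ^ i)`, with `i = 0, …, k - 1` and `q = |F|`,
evaluated at `y`. -/
def linearizedEval {k : ℕ} (a : Fin k → K) (y : K) : K :=
  ∑ i, a i * y ^ Fintype.card F ^ (i : ℕ)

/-- The Gabidulin precoding of `a`: its linearized polynomial evaluated at the points `α j`. -/
def gabidulinPrecode {k : ℕ} (α a : Fin k → K) : Fin k → K :=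
  fun j => linearizedEval F a (α j)

variable {F}

/-- The secret sharing scheme with Gabidulin precoding, for one secret symbol `s ∈ K`: draw `ℓ`
uniformly random symbols `ρ`, precode the vector `(s, ρ)`, and encode the result by `G`. -/
def gabidulinScheme [Fintype K] {n ℓ : ℕ} (G : Matrix (Fin n) (Fin (ℓ + 1)) F)
    (α : Fin (ℓ + 1) → K) (s : K) : PMF (Fin n → K) :=
  (PMF.uniformOfFintype (Fin ℓ → K)).map fun ρ =>
    (G.map (algebraMap F K)).mulVec (gabidulinPrecode F α (Fin.cons s ρ))

end Gabidulin

/-- The access structure of all `A` with `∑ j, min |A ∩ Q j| r ≥ κ`. -/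
def localAccessStructure {n m : ℕ} (Q : Fin m → Finset (Fin n)) (r κ : ℕ) :
    Set (Finset (Fin n)) :=
  {A | κ ≤ ∑ j, min (A ∩ Q j).card r}

end

/-! Since `y ↦ y ^ q` is `F`-linear, the share of participant `i` is `Ψ_a` evaluated at the image in
`K` of row `i` of `G`. Because `α` is independent, the rows of `A` embed in `K` without loss of
dimension, so the shares of `A` amount to `Ψ_a` restricted to a space of dimension the rank of those
rows.

For `A` in the access structure the rows have full rank `κ` (`span_rows_eq_top`). A linearized
polynomial with `κ` coefficients has too few roots to vanish on such a space unless it is zero, so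
`a`, hence the secret, is determined. For any other `B` the rank is at most `κ - 1`
(`finrank_span_rows_le`), so some linearized polynomial with prescribed first coefficient `s`
vanishes on that space (`exists_linearizedEval_cons_eq_zero`). Translating the randomness by its
other coefficients carries the encodings of `s` to those of `0` without changing the shares in `B`.
Locality is local recovery of the code, read on rows.

A maximally recoverable code arises by evaluating linearized polynomials at points that sum to zero
over each repair group and satisfy no other relations. -/

noncomputable section


/-! ### Linearized polynomials: roots and interpolation. -/

section LinearizedPolynomials

theorem linearizedEval_add {F K : Type*} [Fintype F] [Field K] {k : ℕ} (a b : Fin k → K) (y : K) :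
    linearizedEval F (a + b) y = linearizedEval F a y + linearizedEval F b y := by
  simp [linearizedEval, add_mul, Finset.sum_add_distrib]

theorem linearizedEval_sub {F K : Type*} [Fintype F] [Field K] {k : ℕ} (a b : Fin k → K) (y : K) :
    linearizedEval F (a - b) y = linearizedEval F a y - linearizedEval F b y := by
  simp [linearizedEval, sub_mul, Finset.sum_sub_distrib]

theorem linearizedEval_smul {F K : Type*} [Fintype F] [Field K] {k : ℕ} (c : K) (a : Fin k → K) (y : K) :
    linearizedEval F (c • a) y = c * linearizedEval F a y := by
  simp [linearizedEval, mul_assoc, Finset.mul_sum]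

/-- Isolates the secret coefficient; the randomness forms a linearized polynomial in `y ^ q`. -/
theorem linearizedEval_cons {F K : Type*} [Fintype F] [Field K] {k : ℕ} (s : K) (ρ : Fin k → K) (y : K) :
    linearizedEval F (Fin.cons s ρ : Fin (k + 1) → K) y =
      s * y + linearizedEval F ρ (y ^ Fintype.card F) := by
  simp [linearizedEval, Fin.sum_univ_succ, ← pow_mul, pow_succ']

variable {F K : Type*} [Field F] [Fintype F] [Field K] [Algebra F K]

variable (F) in
/-- The linearized polynomial with coefficients `a`, as an `F`-linear map in its argument. -/
def linearizedMap {k : ℕ} (a : Fin k → K) : K →ₗ[F] K :=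
  ∑ i, a i • ((FiniteField.frobeniusAlgHom F K) ^ (i : ℕ)).toLinearMap

theorem linearizedMap_apply {k : ℕ} (a : Fin k → K) (y : K) :
    linearizedMap F a y = linearizedEval F a y := by
  simp [linearizedMap, linearizedEval, AlgHom.coe_pow, FiniteField.coe_frobeniusAlgHom, pow_iterate]

open Polynomial in
/-- A linearized polynomial with `k` coefficients vanishing on a space of dimension `k` is zero. -/
theorem eq_zero_of_linearizedEval_eq_zero {k : ℕ} (a : Fin k → K) (V : Submodule F K)
    (hV : k ≤ Module.finrank F V) (h : ∀ y ∈ V, linearizedEval F a y = 0) : a = 0 := by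
  rcases Nat.eq_zero_or_pos k with rfl | hk
  · exact Subsingleton.elim _ _
  have : Module.Finite F V := Module.finite_of_finrank_pos (hk.trans_le hV)
  have : Finite V := Module.finite_of_finite F
  have : Fintype V := Fintype.ofFinite V
  have hq : 1 < Fintype.card F := Fintype.one_lt_card
  -- The degree is at most `q ^ (k - 1)`, while all `q ^ dim V` points of `V` are roots.
  set P : K[X] := ∑ i, C (a i) * X ^ Fintype.card F ^ (i : ℕ) with hP
  have hP0 : P = 0 := by
    refine eq_zero_of_natDegree_lt_card_of_eval_eq_zero P (f := ((↑) : V → K))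
      Subtype.val_injective (fun y => ?_) ?_
    · simpa [hP, eval_finsetSum, linearizedEval] using h y y.2
    · rw [Module.card_eq_pow_finrank (K := F)]
      calc P.natDegree ≤ Fintype.card F ^ (k - 1) := by
            refine natDegree_sum_le_of_forall_le _ _ fun i _ => ?_
            exact (natDegree_C_mul_X_pow_le _ _).trans
              (Nat.pow_le_pow_right hq.le (by have := i.2; omega))
        _ < Fintype.card F ^ Module.finrank F V := Nat.pow_lt_pow_right hq (by omega)
  ext i
  have hc := congrArg (fun p => coeff p (Fintype.card F ^ (i : ℕ))) hP0
  simpa [hP, finsetSum_coeff, coeff_C_mul, coeff_X_pow, (Nat.pow_right_injective hq).eq_iff,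
    Fin.val_inj] using hc

/-- Pads the space to dimension exactly `k`, so that the interpolation system below is square. -/
theorem exists_submodule_le_finrank_eq {F K : Type*} [Field F] [AddCommGroup K] [Module F K]
    {V : Submodule F K} [Module.Finite F K] {m : ℕ}
    (hV : Module.finrank F V ≤ m) (hm : m ≤ Module.finrank F K) :
    ∃ W : Submodule F K, V ≤ W ∧ Module.finrank F W = m := by
  induction m, hV using Nat.le_induction with
  | base => exact ⟨V, le_rfl, rfl⟩
  | succ m _ ih =>
    obtain ⟨W, hVW, hW⟩ := ih (by omega)
    have hne : W ≠ ⊤ := by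
      rintro rfl
      rw [finrank_top] at hW
      omega
    obtain ⟨v, hv⟩ : ∃ v, v ∉ W := by
      by_contra! hall
      exact hne (Submodule.eq_top_iff'.2 hall)
    exact ⟨W ⊔ F ∙ v, hVW.trans le_sup_left, by rw [Submodule.finrank_sup_span_singleton hv, hW]⟩

/-- A space of dimension at most `k` lies in the kernel of a linearized polynomial with `k + 1`
coefficients, the first of which is prescribed. -/
theorem exists_linearizedEval_cons_eq_zero [Module.Finite F K] {k : ℕ} (V : Submodule F K)
    (hV : Module.finrank F V ≤ k) (hk : k ≤ Module.finrank F K) (s : K) :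
    ∃ ρ : Fin k → K, ∀ y ∈ V, linearizedEval F (Fin.cons s ρ : Fin (k + 1) → K) y = 0 := by
  obtain ⟨W, hVW, hW⟩ := exists_submodule_le_finrank_eq hV hk
  let b := Module.finBasisOfFinrankEq F W hW
  -- `M ρ` lists the values of `ρ` at the `q`-th powers of a basis of `W`. These span the Frobenius
  -- image of `W`, again of dimension `k`, so `M` is injective and hence surjective.
  let M : (Fin k → K) →ₗ[K] (Fin k → K) :=
    { toFun := fun ρ i => linearizedEval F ρ ((b i : K) ^ Fintype.card F)
      map_add' := fun ρ ρ' => funext fun i => linearizedEval_add ρ ρ' _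
      map_smul' := fun c ρ => funext fun i => linearizedEval_smul c ρ _ }
  have hM : Function.Injective M := by
    rw [← LinearMap.ker_eq_bot, LinearMap.ker_eq_bot']
    intro ρ hρ
    let φ : K →ₗ[F] K := (FiniteField.frobeniusAlgHom F K).toLinearMap
    have hφ : Function.Injective φ := (FiniteField.frobeniusAlgHom F K).toRingHom.injective
    refine eq_zero_of_linearizedEval_eq_zero (F := F) ρ (W.map φ) ?_ ?_
    · rw [(Submodule.equivMapOfInjective φ hφ W).symm.finrank_eq, hW]
    · rintro _ ⟨y, hy, rfl⟩
      have h0 : (linearizedMap F ρ ∘ₗ φ) ∘ₗ W.subtype = 0 := b.ext fun i => by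
        simpa [linearizedMap_apply, φ, M] using congrFun hρ i
      simpa [linearizedMap_apply] using LinearMap.congr_fun h0 ⟨y, hy⟩
  obtain ⟨ρ, hρ⟩ := (LinearMap.injective_iff_surjective.1 hM) fun i => -(s * b i)
  refine ⟨ρ, fun y hy => ?_⟩
  have h0 : linearizedMap F (Fin.cons s ρ : Fin (k + 1) → K) ∘ₗ W.subtype = 0 := b.ext fun i => by
    have := congrFun hρ i
    simp only [M, LinearMap.coe_mk, AddHom.coe_mk] at this
    simp [linearizedMap_apply, linearizedEval_cons, this]
  simpa [linearizedMap_apply] using LinearMap.congr_fun h0 ⟨y, hVW hy⟩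

end LinearizedPolynomials

/-! ### Entropy criteria for determination and independence. -/

section Entropy

theorem PMF.toReal_map_snd_eq_sum {β γ : Type*} [Fintype β] (p : PMF (β × γ)) (y : γ) :
    ((p.map Prod.snd) y).toReal = ∑ x, (p (x, y)).toReal := by
  classical
  rw [← ENNReal.toReal_sum fun x _ => p.apply_ne_top (x, y), PMF.map_apply, ENNReal.tsum_prod',
    tsum_fintype]
  refine congrArg _ (Finset.sum_congr rfl fun x _ => ?_)
  rw [tsum_eq_single y fun y' hy' => by simp [hy'.symm]]
  simp

/-- If `Y` determines `X` almost surely then `H(X | Y) = 0`. -/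
theorem condShannonEntropy_eq_zero {Ω β γ : Type*} [Fintype β] [Fintype γ] (p : PMF Ω)
    (X : Ω → β) (Y : Ω → γ)
    (h : ∀ ω ∈ p.support, ∀ ω' ∈ p.support, Y ω = Y ω' → X ω = X ω') :
    condShannonEntropy p X Y = 0 := by
  refine Finset.sum_eq_zero fun y _ => mul_eq_zero_of_right _ (Finset.sum_eq_zero fun x _ => ?_)
  set P := p.map fun ω => (X ω, Y ω) with hP
  have hY : p.map Y = P.map Prod.snd := by rw [hP, PMF.map_comp]; rfl
  rw [hY, PMF.toReal_map_snd_eq_sum]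
  by_cases hx : P (x, y) = 0
  · simp [hx]
  have hx' : ∀ x', x' ≠ x → P (x', y) = 0 := by
    intro x' hne
    by_contra hx'
    rw [← ne_eq, ← PMF.mem_support_iff, hP, PMF.mem_support_map_iff] at hx hx'
    obtain ⟨ω, hω, he⟩ := hx
    obtain ⟨ω', hω', he'⟩ := hx'
    simp only [Prod.mk.injEq] at he he'
    exact hne (by rw [← he.1, ← he'.1, h ω' hω' ω hω (he'.2.trans he.2.symm)])
  -- Given `y`, all the mass sits at `x`, so the quotient is `1` and `negMulLog 1 = 0`.
  rw [Finset.sum_eq_single x (fun x' _ hne => by simp [hx' x' hne]) (by simp), div_self]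
  · simp
  · exact ENNReal.toReal_ne_zero.2 ⟨hx, P.apply_ne_top _⟩

/-- If `X` and `Y` are independent then `H(X | Y) = H(X)`. -/
theorem condShannonEntropy_eq_shannonEntropy {Ω β γ : Type*} [Fintype β] [Fintype γ] (p : PMF Ω)
    (X : Ω → β) (Y : Ω → γ)
    (h : ∀ x y, ((p.map fun ω => (X ω, Y ω)) (x, y)).toReal =
      ((p.map X) x).toReal * ((p.map Y) y).toReal) :
    condShannonEntropy p X Y = shannonEntropy p X := by
  have h1 : ∑ y, ((p.map Y) y).toReal = 1 := by
    rw [← ENNReal.toReal_sum fun y _ => PMF.apply_ne_top _ _, ← tsum_fintype (L := .unconditional _),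
      PMF.tsum_coe, ENNReal.toReal_one]
  calc condShannonEntropy p X Y
      = ∑ y, ((p.map Y) y).toReal * shannonEntropy p X := by
        refine Finset.sum_congr rfl fun y _ => ?_
        -- For a null `y` the conditional probabilities are default values, but their weight is
        -- zero.
        by_cases hy : ((p.map Y) y).toReal = 0
        · rw [hy, zero_mul, zero_mul]
        · simp only [h, mul_div_cancel_right₀ _ hy, shannonEntropy]
    _ = shannonEntropy p X := by rw [← Finset.sum_mul, h1, one_mul]

theorem mem_support_jointLaw {n : ℕ} {S T : Type*} [Fintype S] [Nonempty S] {f : S → PMF (Fin n → T)} {ω : S × (Fin n → T)} :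
    ω ∈ (jointLaw f).support ↔ ω.2 ∈ (f ω.1).support := by
  obtain ⟨s, c⟩ := ω
  simp [jointLaw, eq_comm]

variable {n : ℕ} {S T : Type*} [Fintype S] [Nonempty S] [Fintype T]

/-- If the law of the shares in `B` does not depend on the secret, they have no information
on it. -/
theorem condShannonEntropy_secretVar_eq (f : S → PMF (Fin n → T)) (B : Finset (Fin n))
    (h : ∀ s s', (f s).map (fun c (i : B) => c i) = (f s').map (fun c (i : B) => c i)) :
    condShannonEntropy (jointLaw f) secretVar (sharesVar B) =
      shannonEntropy (jointLaw f) secretVar := by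
  classical
  obtain ⟨s₀⟩ := ‹Nonempty S›
  set μ := (f s₀).map (fun c (i : B) => c i) with hμ
  -- Secret and shares have the product law of the uniform law and `μ`.
  have hJ : ((jointLaw f).map fun ω => (secretVar ω, sharesVar B ω)) =
      (PMF.uniformOfFintype S).bind fun s => μ.map (Prod.mk s) := by
    rw [jointLaw, PMF.map_bind]
    congr 1
    funext s
    rw [hμ, h s₀ s, PMF.map_comp, PMF.map_comp]
    rfl
  have hX : (jointLaw f).map secretVar = PMF.uniformOfFintype S := by
    rw [jointLaw, PMF.map_bind]
    conv_rhs => rw [← PMF.bind_pure (PMF.uniformOfFintype S)]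
    congr 1
    funext s
    rw [PMF.map_comp]
    exact PMF.map_const _ _
  have hY : (jointLaw f).map (sharesVar B) = μ := by
    rw [jointLaw, PMF.map_bind]
    conv_rhs => rw [← PMF.bind_const (PMF.uniformOfFintype S) μ]
    congr 1
    funext s
    rw [PMF.map_comp, hμ, h s₀ s]
    rfl
  refine condShannonEntropy_eq_shannonEntropy _ _ _ fun s y => ?_
  rw [hJ, hX, hY, ← ENNReal.toReal_mul, PMF.bind_apply]
  rw [tsum_eq_single s]
  · congr 2
    rw [PMF.map_apply, tsum_eq_single y]
    · simp
    · intro y' hy'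
      simp [hy'.symm]
  · intro s' hs'
    rw [PMF.map_apply]
    simp [hs'.symm]

theorem PMF.map_equiv_uniformOfFintype {α : Type*} [Fintype α] [Nonempty α] (e : α ≃ α) :
    (PMF.uniformOfFintype α).map e = PMF.uniformOfFintype α := by
  classical
  ext x
  rw [PMF.map_apply, tsum_eq_single (e.symm x)]
  · simp
  · intro y hy
    rw [if_neg]
    rintro rfl
    simp at hy

end Entropy

/-! ### Repair groups, transversals and the access structure. -/

section RepairPartitions

variable {n r : ℕ} {Q : Fin (n / (r + 1)) → Finset (Fin n)}

theorem IsRepairPartition.eq_of_mem (hQ : IsRepairPartition r Q) {i : Fin n}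
    {j j' : Fin (n / (r + 1))} (h : i ∈ Q j) (h' : i ∈ Q j') : j = j' :=
  (hQ.existsUnique_mem i).unique h h'

theorem IsRepairPartition.sum_card_inter (hQ : IsRepairPartition r Q) (B : Finset (Fin n)) :
    ∑ j, (B ∩ Q j).card = B.card := by
  rw [← Finset.card_biUnion]
  · congr 1
    ext i
    obtain ⟨j, hj, -⟩ := hQ.existsUnique_mem i
    simp only [Finset.mem_biUnion, Finset.mem_univ, true_and, Finset.mem_inter]
    exact ⟨fun ⟨_, h, _⟩ => h, fun h => ⟨j, h, hj⟩⟩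
  · intro j _ j' _ hne
    refine Finset.disjoint_left.2 fun i hi hi' => ?_
    exact hne (hQ.eq_of_mem (Finset.mem_inter.1 hi).2 (Finset.mem_inter.1 hi').2)

theorem IsRepairPartition.inter_image_eq (hQ : IsRepairPartition r Q)
    {d : Fin (n / (r + 1)) → Fin n} (hd : ∀ j, d j ∈ Q j) (j : Fin (n / (r + 1))) :
    Finset.univ.image d ∩ Q j = {d j} := by
  ext i
  simp only [Finset.mem_inter, Finset.mem_image, Finset.mem_univ, true_and, Finset.mem_singleton]
  constructor
  · rintro ⟨⟨j', rfl⟩, h⟩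
    rw [hQ.eq_of_mem (hd j') h]
  · rintro rfl
    exact ⟨⟨j, rfl⟩, hd j⟩

/-- One may delete one coordinate of each repair group so that `∑ j, min |A ∩ Q j| r` elements of
`A` are kept, and a deleted element of `A` lies in a repair group contained in `A`. -/
theorem IsRepairPartition.exists_transversal (hQ : IsRepairPartition r Q) (A : Finset (Fin n)) :
    ∃ D : Finset (Fin n), (∀ j, (D ∩ Q j).card = 1) ∧
      (A \ D).card = ∑ j, min (A ∩ Q j).card r ∧
      ∀ j, ∀ i ∈ Q j, i ∈ A → i ∈ D → (Q j).erase i ⊆ A \ D := by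
  -- The deleted coordinate is taken outside `A` whenever possible; it costs `A` an element only
  -- when the whole group lies in `A`, which is exactly when `min` truncates `r + 1` to `r`.
  have hex : ∀ j, ∃ i ∈ Q j, i ∈ A → Q j ⊆ A := by
    intro j
    by_cases h : Q j ⊆ A
    · obtain ⟨i, hi⟩ : (Q j).Nonempty := Finset.card_pos.1 (by rw [hQ.card_eq]; omega)
      exact ⟨i, hi, fun _ => h⟩
    · obtain ⟨i, hi, hiA⟩ := Finset.not_subset.1 h
      exact ⟨i, hi, fun h => absurd h hiA⟩
  choose d hd hdA using hex
  have hDQ := hQ.inter_image_eq hd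
  have hsd : ∀ j, (A \ Finset.univ.image d) ∩ Q j = (A ∩ Q j).erase (d j) := by
    intro j
    ext i
    have := Finset.ext_iff.1 (hDQ j) i
    simp only [Finset.mem_inter, Finset.mem_sdiff, Finset.mem_erase, Finset.mem_singleton] at *
    tauto
  refine ⟨Finset.univ.image d, fun j => by rw [hDQ, Finset.card_singleton], ?_, ?_⟩
  · rw [← hQ.sum_card_inter]
    refine Finset.sum_congr rfl fun j _ => ?_
    rw [hsd]
    by_cases h : d j ∈ A
    · have hc : (A ∩ Q j).card = r + 1 := by
        rw [Finset.inter_eq_right.2 (hdA j h), hQ.card_eq]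
      rw [Finset.card_erase_of_mem (Finset.mem_inter.2 ⟨h, hd j⟩), hc]
      omega
    · rw [Finset.erase_eq_of_notMem (fun h' => h (Finset.mem_inter.1 h').1), min_eq_left]
      have : A ∩ Q j ⊆ (Q j).erase (d j) := by
        intro i hi
        rw [Finset.mem_inter] at hi
        exact Finset.mem_erase.2 ⟨fun e => h (e ▸ hi.1), hi.2⟩
      simpa [Finset.card_erase_of_mem (hd j), hQ.card_eq] using Finset.card_le_card this
  · intro j i hi hiA hiD k hk
    have hik : i = d j := by
      simpa [hDQ j] using Finset.mem_inter.2 ⟨hiD, hi⟩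
    subst hik
    rw [Finset.mem_erase] at hk
    refine Finset.mem_sdiff.2 ⟨hdA j hiA hk.2, fun hkD => hk.1 ?_⟩
    simpa [hDQ j] using Finset.mem_inter.2 ⟨hkD, hk.2⟩

theorem mem_localAccessStructure {m κ : ℕ} {Q : Fin m → Finset (Fin n)} {A : Finset (Fin n)} :
    A ∈ localAccessStructure Q r κ ↔ κ ≤ ∑ j, min (A ∩ Q j).card r := Iff.rfl

theorem localAccessStructure_mono {m κ : ℕ} {Q : Fin m → Finset (Fin n)} {A A' : Finset (Fin n)}
    (hA : A ∈ localAccessStructure Q r κ) (h : A ⊆ A') : A' ∈ localAccessStructure Q r κ := by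
  refine le_trans (mem_localAccessStructure.1 hA) (Finset.sum_le_sum fun j _ => ?_)
  exact min_le_min_right _ (Finset.card_le_card (Finset.inter_subset_inter_right h))

theorem IsRepairPartition.univ_mem_localAccessStructure (hQ : IsRepairPartition r Q) {κ : ℕ}
    (hn : (r + 1) ∣ n) (h : κ * (r + 1) ≤ n * r) :
    Finset.univ ∈ localAccessStructure Q r κ := by
  rw [mem_localAccessStructure]
  obtain ⟨g, rfl⟩ := hn
  simp only [Finset.univ_inter, hQ.card_eq, Finset.sum_const, Finset.card_univ, Fintype.card_fin,
    Nat.mul_div_cancel_left g (Nat.succ_pos r), smul_eq_mul, min_eq_right (Nat.le_succ r)]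
  nlinarith

theorem IsRepairPartition.card_ge_of_mem_localAccessStructure (hQ : IsRepairPartition r Q) {κ : ℕ}
    {A : Finset (Fin n)} (hA : A ∈ localAccessStructure Q r κ) : κ ≤ A.card := by
  refine le_trans (mem_localAccessStructure.1 hA) ?_
  rw [← hQ.sum_card_inter A]
  exact Finset.sum_le_sum fun j _ => min_le_left _ _

end RepairPartitions

/-! ### Minimum distance, MDS codes and recovery sets through zeros of codewords. -/

section Codes

variable {F ι : Type*} [Field F] [Fintype ι]

open Classical in
-- By linearity, distances are weights of differences. The witness in `h2` also rules out the
-- default value `sInf ∅ = 0`.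
theorem codeMinDist_eq (C : Submodule F (ι → F)) (d : ℕ)
    (h1 : ∀ u ∈ C, u ≠ 0 → d ≤ hammingNorm u) (h2 : ∃ u ∈ C, u ≠ 0 ∧ hammingNorm u ≤ d) :
    codeMinDist C = d := by
  obtain ⟨u, hu, hu0, hud⟩ := h2
  have hmem : d ∈ {d | ∃ u ∈ C, ∃ v ∈ C, u ≠ v ∧ hammingDist u v = d} :=
    ⟨u, hu, 0, C.zero_mem, hu0, by
      rw [hammingDist_zero_right]; exact le_antisymm hud (h1 u hu hu0)⟩
  refine le_antisymm (Nat.sInf_le hmem) (le_csInf ⟨d, hmem⟩ ?_)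
  rintro _ ⟨v, hv, w, hw, hvw, rfl⟩
  rw [hammingDist_comm, hammingDist_eq_hammingNorm, neg_add_eq_sub]
  exact h1 _ (C.sub_mem hv hw) (sub_ne_zero.2 hvw)

open Classical in
theorem codeMinDist_le_hammingNorm (C : Submodule F (ι → F)) {u : ι → F} (hu : u ∈ C)
    (hu0 : u ≠ 0) : codeMinDist C ≤ hammingNorm u :=
  Nat.sInf_le ⟨u, hu, 0, C.zero_mem, hu0, hammingDist_zero_right u⟩

open Classical in
theorem hammingNorm_add_card_zeros (u : ι → F) :
    hammingNorm u + (Finset.univ.filter fun i => u i = 0).card = Fintype.card ι := by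
  rw [hammingNorm, add_comm, Finset.card_filter_add_card_filter_not, Finset.card_univ]

open Classical in
/-- Fewer linear conditions than the dimension have a nonzero solution in the code. -/
theorem exists_ne_zero_of_card_lt_finrank (C : Submodule F (ι → F)) (B : Finset ι)
    (h : B.card < Module.finrank F C) : ∃ u ∈ C, u ≠ 0 ∧ ∀ i ∈ B, u i = 0 := by
  have hk := LinearMap.ker_ne_bot_of_finrank_lt
    (f := (LinearMap.funLeft F F ((↑) : B → ι)).comp C.subtype) (by simpa using h)
  obtain ⟨u, hu, hu0⟩ := Submodule.exists_mem_ne_zero_of_ne_bot hk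
  exact ⟨u, u.2, by simpa using hu0, fun i hi => congrFun (LinearMap.mem_ker.1 hu) ⟨i, hi⟩⟩

open Classical in
-- A nonzero codeword with `dim - 1` prescribed zeros always exists, so only the lower bound on
-- weights is at stake. The zero code is excluded because its `codeMinDist` is the default `0`.
theorem isMDSCode_of_forall (C : Submodule F (ι → F)) (hk : 0 < Module.finrank F C)
    (h : ∀ u ∈ C, Module.finrank F C ≤ (Finset.univ.filter fun i => u i = 0).card → u = 0) :
    IsMDSCode C := by
  have hle : Module.finrank F C ≤ Fintype.card ι := by
    simpa using Submodule.finrank_le C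
  rw [IsMDSCode, codeMinDist_eq C (Fintype.card ι + 1 - Module.finrank F C)]
  · omega
  · intro u hu hu0
    have := hammingNorm_add_card_zeros u
    have := mt (h u hu) hu0
    omega
  · obtain ⟨B, -, hB⟩ := Finset.exists_subset_card_eq (s := (Finset.univ : Finset ι))
      (n := Module.finrank F C - 1) (by rw [Finset.card_univ]; omega)
    obtain ⟨u, hu, hu0, huB⟩ := exists_ne_zero_of_card_lt_finrank C B (by omega)
    have := hammingNorm_add_card_zeros u
    have : B.card ≤ (Finset.univ.filter fun i => u i = 0).card :=
      Finset.card_le_card fun i hi => by simpa using huB i hi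
    exact ⟨u, hu, hu0, by omega⟩

open Classical in
theorem IsMDSCode.eq_zero {C : Submodule F (ι → F)} (hC : IsMDSCode C) {u : ι → F} (hu : u ∈ C)
    (h : Module.finrank F C ≤ (Finset.univ.filter fun i => u i = 0).card) : u = 0 := by
  by_contra hu0
  have := hammingNorm_add_card_zeros u
  have := codeMinDist_le_hammingNorm C hu hu0
  rw [IsMDSCode] at hC
  omega

theorem IsRecoverySet.apply_eq_zero {n : ℕ} {C : Submodule F (Fin n → F)} {i : Fin n}
    {R : Finset (Fin n)} (hR : IsRecoverySet C i R) {u : Fin n → F} (hu : u ∈ C)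
    (h : ∀ j ∈ R, u j = 0) : u i = 0 := by
  by_contra hi
  obtain ⟨j, hj, hne⟩ := hR.2 u hu 0 C.zero_mem hi
  exact hne (h j hj)

theorem IsRecoverySet.of_apply_eq_zero {n : ℕ} {C : Submodule F (Fin n → F)} {i : Fin n}
    {R : Finset (Fin n)} (hi : i ∉ R) (h : ∀ u ∈ C, (∀ j ∈ R, u j = 0) → u i = 0) :
    IsRecoverySet C i R := by
  refine ⟨hi, fun u hu v hv hne => ?_⟩
  by_contra! hall
  have := h (u - v) (C.sub_mem hu hv) fun j hj => by simp [hall j hj]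
  exact hne (sub_eq_zero.1 this)

end Codes

/-! ### Criteria for maximal recoverability. -/

section MaximallyRecoverable

variable {F : Type*} [Field F] {n r κ : ℕ} {Q : Fin (n / (r + 1)) → Finset (Fin n)}
  {C : Submodule F (Fin n → F)}

/-- A codeword vanishing off a transversal of the repair groups is zero. -/
theorem IsRepairPartition.eq_zero_of_off_transversal (hQ : IsRepairPartition r Q)
    (hrec : ∀ j, ∀ i ∈ Q j, IsRecoverySet C i ((Q j).erase i))
    {D : Finset (Fin n)} (hD : ∀ j, (D ∩ Q j).card = 1) {u : Fin n → F} (hu : u ∈ C)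
    (h : ∀ i, i ∉ D → u i = 0) : u = 0 := by
  ext i
  by_cases hi : i ∈ D
  · obtain ⟨j, hj, -⟩ := hQ.existsUnique_mem i
    refine (hrec j i hj).apply_eq_zero hu fun k hk => h k fun hkD => ?_
    obtain ⟨x, hx⟩ := Finset.card_eq_one.1 (hD j)
    rw [Finset.mem_erase] at hk
    have h1 : k ∈ D ∩ Q j := Finset.mem_inter.2 ⟨hkD, hk.2⟩
    have h2 : i ∈ D ∩ Q j := Finset.mem_inter.2 ⟨hi, hj⟩
    rw [hx, Finset.mem_singleton] at h1 h2
    exact hk.1 (h1.trans h2.symm)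
  · exact h i hi

/-- Each deleted coordinate is recovered from the rest of its group, so this puncturing is injective
on `C`. -/
theorem IsRepairPartition.finrank_puncturedCode (hQ : IsRepairPartition r Q)
    (hrec : ∀ j, ∀ i ∈ Q j, IsRecoverySet C i ((Q j).erase i))
    {D : Finset (Fin n)} (hD : ∀ j, (D ∩ Q j).card = 1) :
    Module.finrank F (puncturedCode C D) = Module.finrank F C := by
  set P := LinearMap.funLeft F F (Subtype.val : {i : Fin n // i ∉ D} → Fin n) with hP
  have hinj : Function.Injective (P.domRestrict C) := by
    rw [← LinearMap.ker_eq_bot, LinearMap.ker_eq_bot']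
    intro u hu
    exact Subtype.ext (hQ.eq_zero_of_off_transversal hrec hD u.2 fun i hi => congrFun hu ⟨i, hi⟩)
  have := (LinearEquiv.ofInjective _ hinj).finrank_eq
  rw [LinearMap.range_domRestrict] at this
  exact this.symm

open Classical in
theorem card_zeros_off (D : Finset (Fin n)) (u : Fin n → F) :
    (Finset.univ.filter fun i : {i : Fin n // i ∉ D} => u i = 0).card =
      (Finset.univ.filter fun i => i ∉ D ∧ u i = 0).card := by
  rw [← Finset.card_map (Function.Embedding.subtype _)]
  congr 1
  ext i
  simp [and_comm]

open Classical in
-- A transversal adapted to `A` leaves `∑ j, min |A ∩ Q j| r ≥ κ` zeros. Then `hgen`, the MDS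
-- property in terms of zeros, kills the kept coordinates and local recovery the deleted ones.
-- Keeping `hgen` as a hypothesis lets the lemma also serve to prove that a code is maximally
-- recoverable.
theorem IsRepairPartition.eq_zero_of_mem_localAccessStructure (hQ : IsRepairPartition r Q)
    (hrec : ∀ j, ∀ i ∈ Q j, IsRecoverySet C i ((Q j).erase i))
    (hgen : ∀ D : Finset (Fin n), (∀ j, (D ∩ Q j).card = 1) → ∀ u ∈ C,
      κ ≤ (Finset.univ.filter fun i => i ∉ D ∧ u i = 0).card → ∀ i, i ∉ D → u i = 0)
    {A : Finset (Fin n)} (hA : A ∈ localAccessStructure Q r κ) {u : Fin n → F} (hu : u ∈ C)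
    (h : ∀ i ∈ A, u i = 0) : u = 0 := by
  obtain ⟨D, hD, hcard, -⟩ := hQ.exists_transversal A
  refine hQ.eq_zero_of_off_transversal hrec hD hu (hgen D hD u hu ?_)
  refine (mem_localAccessStructure.1 hA).trans (hcard.symm.trans_le ?_)
  refine Finset.card_le_card fun k hk => ?_
  rw [Finset.mem_sdiff] at hk
  simp [hk.2, h k hk.1]

/-- A codeword of a maximally recoverable code vanishing on a set of the access structure is
zero. -/
theorem IsMaximallyRecoverable.eq_zero (hC : IsMaximallyRecoverable C κ r Q)
    {A : Finset (Fin n)} (hA : A ∈ localAccessStructure Q r κ) {u : Fin n → F} (hu : u ∈ C)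
    (h : ∀ i ∈ A, u i = 0) : u = 0 := by
  classical
  refine hC.partition.eq_zero_of_mem_localAccessStructure hC.recovery
    (fun D hD u hu hle i hi => ?_) hA hu h
  have hmem : LinearMap.funLeft F F (Subtype.val : {i : Fin n // i ∉ D} → Fin n) u ∈
    puncturedCode C D := Submodule.mem_map_of_mem hu
  refine congrFun ((hC.mds D hD).eq_zero hmem ?_) ⟨i, hi⟩
  rw [hC.partition.finrank_puncturedCode hC.recovery hD, hC.optimal.finrank_eq]
  exact hle.trans (card_zeros_off D u).ge

/-- With `f` repair groups inside `A`, `|A| = ∑ min + f` and `r * f ≤ ∑ min ≤ r * m - 1`. Hence `f ≤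
m - 1`, and each of the two summands loses one. -/
theorem IsRepairPartition.card_add_two_le (hQ : IsRepairPartition r Q) {m : ℕ}
    {A : Finset (Fin n)} (hA : A ∉ localAccessStructure Q r (r * m)) :
    A.card + 2 ≤ r * m + m := by
  rw [mem_localAccessStructure, not_le] at hA
  set f := (Finset.univ.filter fun j => (A ∩ Q j).card = r + 1).card with hf
  have hle : ∀ j, (A ∩ Q j).card ≤ r + 1 := fun j =>
    (Finset.card_le_card Finset.inter_subset_right).trans (hQ.card_eq j).le
  have h1 : A.card = ∑ j, min (A ∩ Q j).card r + f := by
    rw [← hQ.sum_card_inter A, hf, Finset.card_filter, ← Finset.sum_add_distrib]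
    refine Finset.sum_congr rfl fun j _ => ?_
    have := hle j
    split_ifs <;> omega
  have h2 : r * f ≤ ∑ j, min (A ∩ Q j).card r := by
    rw [hf, Finset.card_filter, Finset.mul_sum]
    refine Finset.sum_le_sum fun j _ => ?_
    split_ifs with h
    · simp [h]
    · simp
  have h3 : f < m := Nat.lt_of_mul_lt_mul_left (h2.trans_lt hA)
  omega

open Classical in
/-- A code with recovery sets inside `m` repair groups has a nonzero codeword with
`m * (r + 1) - 2` zeros, if its dimension is `r * m`. -/
theorem IsRepairPartition.exists_codeword (hQ : IsRepairPartition r Q)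
    (hrec : ∀ j, ∀ i ∈ Q j, IsRecoverySet C i ((Q j).erase i)) (hr : 0 < r) {m : ℕ} (hm : 0 < m)
    (hmn : m ≤ n / (r + 1)) (hfin : Module.finrank F C = r * m) :
    ∃ u ∈ C, u ≠ 0 ∧ r * m + m ≤ (Finset.univ.filter fun i => u i = 0).card + 2 := by
  have hex : ∀ j, ∃ i, i ∈ Q j := fun j => Finset.card_pos.1 (by rw [hQ.card_eq]; omega)
  choose d hd using hex
  obtain ⟨J, -, hJ⟩ := Finset.exists_subset_card_eq (n := m)
    (s := (Finset.univ : Finset (Fin (n / (r + 1))))) (by simpa using hmn)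
  obtain ⟨j₀, hj₀⟩ : J.Nonempty := Finset.card_pos.1 (by omega)
  have hdisj : ∀ j j', j ≠ j' → Disjoint (Q j) (Q j') := fun j j' hne =>
    Finset.disjoint_left.2 fun i hi hi' => hne (hQ.eq_of_mem hi hi')
  set U := J.biUnion Q with hU
  set B := J.biUnion fun j => (Q j).erase (d j) with hB
  have hUc : U.card = m * (r + 1) := by
    rw [hU, Finset.card_biUnion fun j _ j' _ hne => hdisj j j' hne]
    simp [hQ.card_eq, hJ]
  have hBc : B.card = m * r := by
    rw [hB, Finset.card_biUnion fun j _ j' _ hne => (hdisj j j' hne).mono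
      (Finset.erase_subset _ _) (Finset.erase_subset _ _)]
    simp [hQ.card_eq, hJ, Finset.card_erase_of_mem (hd _)]
  obtain ⟨x, hx⟩ : ((Q j₀).erase (d j₀)).Nonempty := Finset.card_pos.1 (by
    rw [Finset.card_erase_of_mem (hd _), hQ.card_eq]; omega)
  have hxB : x ∈ B := Finset.mem_biUnion.2 ⟨j₀, hj₀, hx⟩
  -- Imposing zeros on `r` coordinates of each of `m` groups, save one, gives `r * m - 1`
  -- conditions.
  have hlt : (B.erase x).card < Module.finrank F C := by
    rw [Finset.card_erase_of_mem hxB, hBc, hfin, mul_comm]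
    have := Nat.mul_pos hr hm
    omega
  obtain ⟨u, hu, hu0, huB⟩ := exists_ne_zero_of_card_lt_finrank C _ hlt
  refine ⟨u, hu, hu0, ?_⟩
  -- In the groups of `J` other than `Q j₀` the omitted coordinate vanishes by recovery; only `d j₀`
  -- and `x` may be nonzero in `U`.
  have hsub : (U.erase (d j₀)).erase x ⊆ Finset.univ.filter fun i => u i = 0 := by
    intro i hi
    simp only [Finset.mem_erase, hU, Finset.mem_biUnion] at hi
    obtain ⟨hix, hid, j, hj, hij⟩ := hi
    rw [Finset.mem_filter]
    refine ⟨Finset.mem_univ _, ?_⟩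
    by_cases h : i = d j
    · have hjj : j₀ ≠ j := by
        rintro rfl
        exact hid h
      refine (hrec j i hij).apply_eq_zero hu fun k hk => huB k (Finset.mem_erase.2 ⟨?_, ?_⟩)
      · rintro rfl
        exact hjj (hQ.eq_of_mem (Finset.mem_of_mem_erase hx) (Finset.mem_of_mem_erase hk))
      · exact Finset.mem_biUnion.2 ⟨j, hj, h ▸ hk⟩
    · exact huB i (Finset.mem_erase.2
        ⟨hix, Finset.mem_biUnion.2 ⟨j, hj, Finset.mem_erase.2 ⟨h, hij⟩⟩⟩)
  have h1 := Finset.card_le_card hsub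
  have h2 := Finset.pred_card_le_card_erase (s := U.erase (d j₀)) (a := x)
  have h3 := Finset.pred_card_le_card_erase (s := U) (a := d j₀)
  have h4 : m * (r + 1) = r * m + m := by ring
  omega

open Classical in
/-- A code is maximally recoverable if it has the local recovery sets and a codeword with `κ`
zeros off a transversal of the repair groups vanishes off that transversal. -/
theorem IsRepairPartition.isMaximallyRecoverable (hQ : IsRepairPartition r Q)
    (hrec : ∀ j, ∀ i ∈ Q j, IsRecoverySet C i ((Q j).erase i))
    (hgen : ∀ D : Finset (Fin n), (∀ j, (D ∩ Q j).card = 1) → ∀ u ∈ C,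
      κ ≤ (Finset.univ.filter fun i => i ∉ D ∧ u i = 0).card → ∀ i, i ∉ D → u i = 0)
    (hfin : Module.finrank F C = κ) (hr : 0 < r) (hκ : 0 < κ) (hdvd : r ∣ κ)
    (hn : (r + 1) ∣ n) (hle : κ * (r + 1) ≤ n * r) : IsMaximallyRecoverable C κ r Q := by
  refine ⟨⟨hfin, fun i => ?_, ?_⟩, hQ, hrec, fun D hD => ?_⟩
  · obtain ⟨j, hj, -⟩ := hQ.existsUnique_mem i
    exact ⟨_, by rw [Finset.card_erase_of_mem hj, hQ.card_eq, Nat.add_sub_cancel], hrec j i hj⟩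
  · obtain ⟨m, rfl⟩ := hdvd
    have hm : 0 < m := Nat.pos_of_mul_pos_left hκ
    have hmn : m ≤ n / (r + 1) := by
      obtain ⟨g, rfl⟩ := hn
      rw [Nat.mul_div_cancel_left g (Nat.succ_pos r)]
      refine Nat.le_of_mul_le_mul_left (c := r * (r + 1)) ?_ (by positivity)
      linarith
    obtain ⟨u, hu, hu0, huz⟩ := hQ.exists_codeword hrec hr hm hmn hfin
    have hceil : (r * m) ⌈/⌉ r = m := by
      rw [Nat.ceilDiv_eq_add_pred_div, Nat.add_sub_assoc hr, Nat.mul_add_div hr,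
        Nat.div_eq_of_lt (by omega), add_zero]
    -- The zero set of a nonzero codeword lies outside the access structure, so `u` has the most
    -- zeros possible and its weight is the minimum distance.
    have hall : ∀ v ∈ C, v ≠ 0 → (Finset.univ.filter fun i => v i = 0).card + 2 ≤ r * m + m := by
      intro v hv hv0
      refine hQ.card_add_two_le fun hA => hv0 ?_
      exact hQ.eq_zero_of_mem_localAccessStructure hrec hgen hA hv (by simp)
    have hlen : ∀ v : Fin n → F, hammingNorm v +
        (Finset.univ.filter fun i => v i = 0).card = n := fun v => by
      simpa using hammingNorm_add_card_zeros v
    rw [hceil, codeMinDist_eq C (hammingNorm u) _ ⟨u, hu, hu0, le_rfl⟩]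
    · have := hall u hu hu0
      have := hlen u
      omega
    · intro v hv hv0
      have := hall v hv hv0
      have := hlen u
      have := hlen v
      omega
  · have hP := hQ.finrank_puncturedCode hrec hD
    refine isMDSCode_of_forall _ (by omega) ?_
    rintro _ ⟨u, hu, rfl⟩ h
    rw [hP, hfin] at h
    ext i
    exact hgen D hD u hu (h.trans (card_zeros_off D u).le) i i.2

end MaximallyRecoverable

/-! ### Locality, recovery and security of the Gabidulin scheme. -/

section GabidulinScheme

/-- Double orthogonality; it converts statements on zeros of codewords into statements on spans of
rows. -/
theorem mem_span_of_forall_dotProduct {F : Type*} [Field F] {m : Type*} [Fintype m]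
    {W : Set (m → F)} {v : m → F}
    (h : ∀ x : m → F, (∀ w ∈ W, w ⬝ᵥ x = 0) → v ⬝ᵥ x = 0) : v ∈ Submodule.span F W := by
  classical
  by_contra hv
  obtain ⟨f, hfv, hf⟩ := Submodule.exists_le_ker_of_notMem hv
  have hdot : ∀ w, f w = w ⬝ᵥ fun i => f fun j => if i = j then 1 else 0 := fun w => by
    rw [LinearMap.pi_apply_eq_sum_univ f w]
    rfl
  refine hfv ?_
  rw [hdot]
  refine h _ fun w hw => ?_
  rw [← hdot]
  exact hf (Submodule.subset_span hw)

variable {F K : Type*} [Field F] [Fintype F] [Field K] [Algebra F K] {n k r : ℕ}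

/-- The share of a participant with row `v` of the generator matrix, as an `F`-linear map in `v`,
for the precoded vector `a`. -/
def gabidulinShare (α a : Fin k → K) : (Fin k → F) →ₗ[F] K :=
  linearizedMap F a ∘ₗ Fintype.linearCombination F α

theorem mulVec_gabidulinPrecode (G : Matrix (Fin n) (Fin k) F) (α a : Fin k → K) (i : Fin n) :
    (G.map (algebraMap F K)).mulVec (gabidulinPrecode F α a) i = gabidulinShare α a (G i) := by
  change ∑ t, algebraMap F K (G i t) * linearizedEval F a (α t) = _
  rw [gabidulinShare, LinearMap.comp_apply, Fintype.linearCombination_apply, map_sum]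
  refine Finset.sum_congr rfl fun t _ => ?_
  rw [map_smul, linearizedMap_apply, Algebra.smul_def]

theorem gabidulinShare_add (α a b : Fin k → K) (v : Fin k → F) :
    gabidulinShare α (a + b) v = gabidulinShare α a v + gabidulinShare α b v := by
  simp [gabidulinShare, linearizedMap_apply, linearizedEval_add]

/-- The difference is a linearized polynomial with `k` coefficients vanishing on the `k`-dimensional
span of `α`. -/
theorem gabidulinShare_injective {α : Fin k → K} (hα : LinearIndependent F α) {a b : Fin k → K}
    (h : (gabidulinShare α a : (Fin k → F) →ₗ[F] K) = gabidulinShare α b) : a = b := by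
  rw [← sub_eq_zero]
  refine eq_zero_of_linearizedEval_eq_zero (F := F) _ (LinearMap.range (Fintype.linearCombination F α))
    ?_ ?_
  · rw [LinearMap.finrank_range_of_inj hα.fintypeLinearCombination_injective]
    simp
  · rintro _ ⟨v, rfl⟩
    have := LinearMap.congr_fun h v
    simp only [gabidulinShare, LinearMap.comp_apply, linearizedMap_apply] at this
    rw [linearizedEval_sub, this, sub_self]

theorem gabidulinShare_eq_of_mem_span {α a b : Fin k → K} {W : Set (Fin k → F)}
    (h : ∀ w ∈ W, gabidulinShare α a w = gabidulinShare α b w) {v : Fin k → F}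
    (hv : v ∈ Submodule.span F W) : gabidulinShare α a v = gabidulinShare α b v :=
  LinearMap.eqOn_span (fun w hw => h w hw) hv

theorem IsGeneratorMatrix.mulVec_mem {F : Type*} [Field F] {G : Matrix (Fin n) (Fin k) F}
    {C : Submodule F (Fin n → F)} (hG : IsGeneratorMatrix G C) (x : Fin k → F) :
    G.mulVec x ∈ C :=
  hG.2 ▸ ⟨x, rfl⟩

theorem IsRecoverySet.row_mem_span {F : Type*} [Field F] {G : Matrix (Fin n) (Fin k) F}
    {C : Submodule F (Fin n → F)} (hG : IsGeneratorMatrix G C) {i : Fin n} {R : Finset (Fin n)}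
    (hR : IsRecoverySet C i R) : G i ∈ Submodule.span F (G '' R) :=
  mem_span_of_forall_dotProduct fun x hx => hR.apply_eq_zero (hG.mulVec_mem x) fun j hj =>
    hx _ ⟨j, hj, rfl⟩

theorem IsMaximallyRecoverable.span_rows_eq_top {F : Type*} [Field F]
    {Q : Fin (n / (r + 1)) → Finset (Fin n)} {G : Matrix (Fin n) (Fin k) F}
    {C : Submodule F (Fin n → F)} (hC : IsMaximallyRecoverable C k r Q)
    (hG : IsGeneratorMatrix G C) {A : Finset (Fin n)} (hA : A ∈ localAccessStructure Q r k) :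
    Submodule.span F (G '' A) = ⊤ := by
  refine Submodule.eq_top_iff'.2 fun v => mem_span_of_forall_dotProduct fun x hx => ?_
  have h0 : G.mulVec x = 0 := hC.eq_zero hA (hG.mulVec_mem x) fun i hi => hx _ ⟨i, hi, rfl⟩
  have hx0 : x = 0 := Matrix.mulVec_injective_iff.2 hG.1 (by rw [h0, Matrix.mulVec_zero])
  rw [hx0, dotProduct_zero]

/-- A row of `A` deleted by the adapted transversal has its whole group in `A`, so it lies in the
span of the kept rows of that group. -/
theorem IsMaximallyRecoverable.finrank_span_rows_le {F : Type*} [Field F]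
    {Q : Fin (n / (r + 1)) → Finset (Fin n)} {G : Matrix (Fin n) (Fin k) F} {κ : ℕ}
    {C : Submodule F (Fin n → F)} (hC : IsMaximallyRecoverable C κ r Q)
    (hG : IsGeneratorMatrix G C) (A : Finset (Fin n)) :
    Module.finrank F (Submodule.span F (G '' A)) ≤ ∑ j, min (A ∩ Q j).card r := by
  classical
  obtain ⟨D, -, hcard, hDA⟩ := hC.partition.exists_transversal A
  have hle : Submodule.span F (G '' A) ≤
      Submodule.span F (((A \ D).image G.row : Finset _) : Set _) := by
    rw [Submodule.span_le, Finset.coe_image]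
    rintro _ ⟨i, hi, rfl⟩
    by_cases hiD : i ∈ D
    · obtain ⟨j, hj, -⟩ := hC.partition.existsUnique_mem i
      exact Submodule.span_mono (Set.image_mono (Finset.coe_subset.2 (hDA j i hj hi hiD)))
        ((hC.recovery j i hj).row_mem_span hG)
    · exact Submodule.subset_span ⟨i, by simpa [hiD] using hi, rfl⟩
  rw [← hcard]
  exact (Submodule.finrank_mono hle).trans
    ((finrank_span_finset_le_card _).trans Finset.card_image_le)

variable [Fintype K] {ℓ : ℕ}

theorem mem_support_jointLaw_gabidulinScheme {G : Matrix (Fin n) (Fin (ℓ + 1)) F}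
    {α : Fin (ℓ + 1) → K} {ω : K × (Fin n → K)}
    (hω : ω ∈ (jointLaw (gabidulinScheme G α)).support) :
    ∃ ρ : Fin ℓ → K, ∀ i, ω.2 i = gabidulinShare α (Fin.cons ω.1 ρ) (G i) := by
  rw [mem_support_jointLaw, gabidulinScheme, PMF.mem_support_map_iff] at hω
  obtain ⟨ρ, -, hρ⟩ := hω
  exact ⟨ρ, fun i => by rw [← hρ, mulVec_gabidulinPrecode]⟩

theorem gabidulinScheme_schemeHasLocality {Q : Fin (n / (r + 1)) → Finset (Fin n)} {κ : ℕ}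
    {G : Matrix (Fin n) (Fin (ℓ + 1)) F} {C : Submodule F (Fin n → F)}
    (hC : IsMaximallyRecoverable C κ r Q) (hG : IsGeneratorMatrix G C) (α : Fin (ℓ + 1) → K) :
    SchemeHasLocality (gabidulinScheme G α) r := by
  intro i
  obtain ⟨j, hj, -⟩ := hC.partition.existsUnique_mem i
  refine ⟨(Q j).erase i, Finset.notMem_erase i _, ?_, ?_⟩
  · rw [Finset.card_erase_of_mem hj, hC.partition.card_eq, Nat.add_sub_cancel]
  · refine condShannonEntropy_eq_zero _ _ _ fun ω hω ω' hω' h => ?_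
    obtain ⟨ρ, hρ⟩ := mem_support_jointLaw_gabidulinScheme hω
    obtain ⟨ρ', hρ'⟩ := mem_support_jointLaw_gabidulinScheme hω'
    rw [shareVar, shareVar, hρ, hρ']
    refine gabidulinShare_eq_of_mem_span ?_ ((hC.recovery j i hj).row_mem_span hG)
    rintro _ ⟨t, ht, rfl⟩
    rw [← hρ, ← hρ']
    exact congrFun h ⟨t, ht⟩

theorem gabidulinScheme_recovery {Q : Fin (n / (r + 1)) → Finset (Fin n)}
    {G : Matrix (Fin n) (Fin (ℓ + 1)) F} {C : Submodule F (Fin n → F)}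
    (hC : IsMaximallyRecoverable C (ℓ + 1) r Q) (hG : IsGeneratorMatrix G C)
    {α : Fin (ℓ + 1) → K} (hα : LinearIndependent F α) {A : Finset (Fin n)}
    (hA : A ∈ localAccessStructure Q r (ℓ + 1)) :
    condShannonEntropy (jointLaw (gabidulinScheme G α)) secretVar (sharesVar A) = 0 := by
  refine condShannonEntropy_eq_zero _ _ _ fun ω hω ω' hω' h => ?_
  obtain ⟨ρ, hρ⟩ := mem_support_jointLaw_gabidulinScheme hω
  obtain ⟨ρ', hρ'⟩ := mem_support_jointLaw_gabidulinScheme hω'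
  have heq := gabidulinShare_injective (a := Fin.cons ω.1 ρ) (b := Fin.cons ω'.1 ρ') hα
    (LinearMap.ext fun v => ?_)
  · exact (Fin.cons_inj.1 heq).1
  · refine gabidulinShare_eq_of_mem_span (W := G '' A) ?_
      (by rw [hC.span_rows_eq_top hG hA]; trivial)
    rintro _ ⟨t, ht, rfl⟩
    rw [← hρ, ← hρ']
    exact congrFun h ⟨t, ht⟩

theorem gabidulinScheme_security {Q : Fin (n / (r + 1)) → Finset (Fin n)}
    {G : Matrix (Fin n) (Fin (ℓ + 1)) F} {C : Submodule F (Fin n → F)}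
    (hC : IsMaximallyRecoverable C (ℓ + 1) r Q) (hG : IsGeneratorMatrix G C)
    {α : Fin (ℓ + 1) → K} (hα : LinearIndependent F α) {B : Finset (Fin n)}
    (hB : B ∉ localAccessStructure Q r (ℓ + 1)) :
    condShannonEntropy (jointLaw (gabidulinScheme G α)) secretVar (sharesVar B) =
      shannonEntropy (jointLaw (gabidulinScheme G α)) secretVar := by
  rw [mem_localAccessStructure, not_le] at hB
  have hV := hC.finrank_span_rows_le hG B
  have hzero : ∀ s : K, (gabidulinScheme G α s).map (fun c (i : B) => c i) =
      (gabidulinScheme G α 0).map (fun c (i : B) => c i) := by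
    intro s
    -- The polynomial `(s, ρ₀)` gives every participant of `B` the share zero; `hB` leaves a space
    -- of dimension at most `ℓ`.
    obtain ⟨ρ₀, hρ₀⟩ := exists_linearizedEval_cons_eq_zero (k := ℓ)
      ((Submodule.span F (G '' B)).map (Fintype.linearCombination F α))
      ((Submodule.finrank_map_le _ _).trans (by omega))
      ((Nat.le_succ ℓ).trans (by simpa using hα.fintype_card_le_finrank)) s
    -- The uniform `ρ` may be replaced by `ρ - ρ₀`, which pairs encodings of `s` and of `0` with
    -- equal shares in `B`.
    conv_rhs => rw [gabidulinScheme, ← PMF.map_equiv_uniformOfFintype (Equiv.subRight ρ₀)]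
    rw [gabidulinScheme, PMF.map_comp, PMF.map_comp, PMF.map_comp]
    congr 1
    funext ρ i
    have hsplit : (Fin.cons s ρ : Fin (ℓ + 1) → K) =
        Fin.cons 0 (ρ - ρ₀) + Fin.cons s ρ₀ := by
      ext t
      refine Fin.cases ?_ (fun t => ?_) t <;> simp
    simp only [Function.comp_apply, mulVec_gabidulinPrecode, Equiv.subRight_apply]
    rw [hsplit, gabidulinShare_add, add_eq_left]
    have := hρ₀ _ (Submodule.mem_map_of_mem (Submodule.subset_span ⟨i, i.2, rfl⟩))
    rwa [← linearizedMap_apply] at this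
  exact condShannonEntropy_secretVar_eq _ _ fun s s' => (hzero s).trans (hzero s').symm

theorem gabidulinScheme_isPerfectScheme {Q : Fin (n / (r + 1)) → Finset (Fin n)}
    {G : Matrix (Fin n) (Fin (ℓ + 1)) F} {C : Submodule F (Fin n → F)}
    (hC : IsMaximallyRecoverable C (ℓ + 1) r Q) (hG : IsGeneratorMatrix G C)
    {α : Fin (ℓ + 1) → K} (hα : LinearIndependent F α) :
    IsPerfectScheme (gabidulinScheme G α) (localAccessStructure Q r (ℓ + 1)) where
  monotone _ hA _ h := localAccessStructure_mono hA h
  recovery _ hA := gabidulinScheme_recovery hC hG hα hA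
  security _ hB := gabidulinScheme_security hC hG hα hB

end GabidulinScheme

/-! ### Existence of maximally recoverable codes and of the other ingredients. -/

section Existence

variable {n r : ℕ} {Q : Fin (n / (r + 1)) → Finset (Fin n)}

/-- There are points, one for each coordinate, that sum to zero over each repair group and have no
other linear relations over `F`. -/
theorem IsRepairPartition.exists_evaluationPoints (hQ : IsRepairPartition r Q) (F K : Type*)
    [Field F] [AddCommGroup K] [Module F K] [Module.Finite F K] (hK : Module.finrank F K = n) :
    ∃ β : Fin n → K, (∀ j, ∑ i ∈ Q j, β i = 0) ∧
      ∀ D B : Finset (Fin n), (∀ j, (D ∩ Q j).card = 1) → Disjoint B D →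
        LinearIndependent F fun i : B => β i := by
  classical
  have hex : ∀ j, ∃ i, i ∈ Q j := fun j => Finset.card_pos.1 (by rw [hQ.card_eq]; omega)
  choose d hd using hex
  choose blk hblk using fun i => (hQ.existsUnique_mem i).exists
  -- `T` subtracts from each coordinate the value at the representative of its group, so its kernel
  -- is the vectors constant on groups. These are exactly the relations between the images of the
  -- unit vectors.
  let T : (Fin n → F) →ₗ[F] (Fin n → F) :=
    LinearMap.id - LinearMap.funLeft F F fun i => d (blk i)
  have hT : ∀ c i, T c i = c i - c (d (blk i)) := fun c i => rfl
  have hblk_eq : ∀ {i j}, i ∈ Q j → blk i = j := fun h => hQ.eq_of_mem (hblk _) h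
  let e : (Fin n → F) ≃ₗ[F] K := LinearEquiv.ofFinrankEq _ _ (by simp [hK])
  have hsum : ∀ (B : Finset (Fin n)) (c : Fin n → F), (∀ i ∉ B, c i = 0) →
      ∑ i ∈ B, c i • e (T (Pi.single i 1)) = e (T c) := by
    intro B c hc
    rw [Finset.sum_subset (Finset.subset_univ B) fun i _ hi => by rw [hc i hi, zero_smul]]
    simp_rw [← map_smul, ← map_sum]
    congr 2
    ext i
    simp [Finset.sum_apply, Pi.single_apply]
  refine ⟨fun i => e (T (Pi.single i 1)), fun j => ?_, fun D B hD hBD => ?_⟩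
  · have h := hsum (Q j) (fun i => if i ∈ Q j then 1 else 0) fun i hi => if_neg hi
    rw [Finset.sum_congr rfl fun i hi => by rw [if_pos hi, one_smul]] at h
    rw [h, (LinearEquiv.map_eq_zero_iff e)]
    ext i
    have hiff : i ∈ Q j ↔ d (blk i) ∈ Q j := by
      constructor
      · intro hi
        rw [hblk_eq hi]
        exact hd j
      · intro hi
        rw [← hQ.eq_of_mem (hd _) hi]
        exact hblk i
    simp [hT, hiff]
  · rw [Fintype.linearIndependent_iff]
    intro g hg
    let c : Fin n → F := fun i => if h : i ∈ B then g ⟨i, h⟩ else 0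
    have hc : ∀ i ∉ B, c i = 0 := fun i hi => dif_neg hi
    have h0 : T c = 0 := by
      rw [← LinearEquiv.map_eq_zero_iff e, ← hsum B c hc, ← hg, ← Finset.sum_coe_sort]
      exact Finset.sum_congr rfl fun i _ => by simp [c]
    have hconst : ∀ i, c i = c (d (blk i)) := fun i => by
      have := congrFun h0 i
      rwa [hT, Pi.zero_apply, sub_eq_zero] at this
    intro i
    -- A relation supported on `B` is constant on each group and zero at the group's element of `D`.
    obtain ⟨x, hx⟩ : (D ∩ Q (blk i)).Nonempty := Finset.card_pos.1 (by rw [hD]; omega)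
    rw [Finset.mem_inter] at hx
    have h1 : c i = 0 := by
      rw [hconst i, ← hblk_eq hx.2, ← hconst x, hc x (Finset.disjoint_right.1 hBD hx.1)]
    simpa [c] using h1

/-- Codewords are the values of linearized polynomials at the points `β`. By `F`-linearity the zero
sum over a group gives local recovery; `κ` zeros off a transversal are independent points, which
force the polynomial to vanish. The code is over `K`, while the Frobenius powers are those of `F`.
-/
theorem IsRepairPartition.exists_isMaximallyRecoverable (hQ : IsRepairPartition r Q) (F K : Type*)
    [Field F] [Fintype F] [Field K] [Algebra F K] [Module.Finite F K]
    (hK : Module.finrank F K = n) {κ : ℕ} (hr : 0 < r) (hκ : 0 < κ) (hdvd : r ∣ κ)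
    (hn : (r + 1) ∣ n) (hle : κ * (r + 1) ≤ n * r) :
    ∃ (C : Submodule K (Fin n → K)) (G : Matrix (Fin n) (Fin κ) K),
      IsMaximallyRecoverable C κ r Q ∧ IsGeneratorMatrix G C := by
  classical
  obtain ⟨β, hβ, hind⟩ := hQ.exists_evaluationPoints F K hK
  let G : Matrix (Fin n) (Fin κ) K := Matrix.of fun i t => β i ^ Fintype.card F ^ (t : ℕ)
  have hG : ∀ a i, G.mulVec a i = linearizedMap F a (β i) := fun a i => by
    rw [linearizedMap_apply]
    simp [G, Matrix.mulVec, dotProduct, linearizedEval, mul_comm]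
  have hzero : ∀ D B : Finset (Fin n), (∀ j, (D ∩ Q j).card = 1) → Disjoint B D → κ ≤ B.card →
      ∀ a, (∀ i ∈ B, G.mulVec a i = 0) → a = 0 := by
    intro D B hD hBD hB a ha
    refine eq_zero_of_linearizedEval_eq_zero (F := F) a
      (Submodule.span F (Set.range fun i : B => β i)) ?_ fun y hy => ?_
    · rwa [finrank_span_eq_card (hind D B hD hBD), Fintype.card_coe]
    · rw [← linearizedMap_apply]
      refine (Submodule.span_le (p := LinearMap.ker (linearizedMap F a))).2 ?_ hy
      rintro _ ⟨i, rfl⟩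
      exact (hG a i).symm.trans (ha i i.2)
  have hinj : Function.Injective G.mulVecLin := by
    rw [← LinearMap.ker_eq_bot, LinearMap.ker_eq_bot']
    intro a ha
    obtain ⟨D, hD, hcard, -⟩ := hQ.exists_transversal Finset.univ
    exact hzero D (Finset.univ \ D) hD Finset.sdiff_disjoint
      ((mem_localAccessStructure.1 (hQ.univ_mem_localAccessStructure hn hle)).trans hcard.ge) a
      fun i _ => congrFun ha i
  refine ⟨LinearMap.range G.mulVecLin, G, ?_, Matrix.mulVec_injective_iff.1 hinj, rfl⟩
  refine hQ.isMaximallyRecoverable ?_ ?_ ?_ hr hκ hdvd hn hle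
  · intro j i hi
    refine IsRecoverySet.of_apply_eq_zero (Finset.notMem_erase i _) ?_
    rintro _ ⟨a, rfl⟩ h
    have h1 := congrArg (linearizedMap F a) (hβ j)
    rw [map_sum, map_zero, ← Finset.add_sum_erase _ _ hi, Finset.sum_eq_zero, add_zero] at h1
    · exact (hG a i).trans h1
    · exact fun t ht => (hG a t).symm.trans (h t ht)
  · rintro D hD _ ⟨a, rfl⟩ h i -
    rw [hzero D _ hD ?_ h a fun i hi => (Finset.mem_filter.1 hi).2.2]
    · simp
    · exact Finset.disjoint_left.2 fun i hi => (Finset.mem_filter.1 hi).2.1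
  · rw [LinearMap.finrank_range_of_inj hinj, Module.finrank_fin_fun]

theorem exists_isRepairPartition (r g : ℕ) :
    ∃ Q : Fin (g * (r + 1) / (r + 1)) → Finset (Fin (g * (r + 1))), IsRepairPartition r Q := by
  have hg : g * (r + 1) / (r + 1) = g := Nat.mul_div_cancel g (Nat.succ_pos r)
  let e : Fin (g * (r + 1) / (r + 1)) × Fin (r + 1) ≃ Fin (g * (r + 1)) :=
    ((finCongr hg).prodCongr (Equiv.refl _)).trans finProdFinEquiv
  refine ⟨fun j => Finset.univ.image fun t => e (j, t), fun j => ?_, fun i => ?_⟩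
  · rw [Finset.card_image_of_injective _ fun t t' h => (Prod.ext_iff.1 (e.injective h)).2,
      Finset.card_univ, Fintype.card_fin]
  · refine ⟨(e.symm i).1, Finset.mem_image.2 ⟨(e.symm i).2, Finset.mem_univ _, by simp⟩, ?_⟩
    rintro j hj
    obtain ⟨t, -, rfl⟩ := Finset.mem_image.1 hj
    simp

/-- The code lives over `GaloisField 2 n`, built over `ZMod 2`. A further extension of degree `n`
supplies `α` as part of a basis, since `κ ≤ n`. -/
theorem IsRepairPartition.exists_ingredients (hQ : IsRepairPartition r Q) {κ : ℕ} (hr : 0 < r)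
    (hκ : 0 < κ) (hdvd : r ∣ κ) (hn : (r + 1) ∣ n) (hle : κ * (r + 1) ≤ n * r) :
    ∃ (F K : Type) (_ : Field F) (_ : Fintype F) (_ : Field K) (_ : Fintype K) (_ : Algebra F K)
      (C : Submodule F (Fin n → F)) (G : Matrix (Fin n) (Fin κ) F) (α : Fin κ → K),
      IsMaximallyRecoverable C κ r Q ∧ IsGeneratorMatrix G C ∧
        n ≤ Module.finrank F K ∧ LinearIndependent F α := by
  have hκn : κ ≤ n := by nlinarith
  have hn0 : n ≠ 0 := by omega
  have : NeZero n := ⟨hn0⟩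
  let F := GaloisField 2 n
  let K := FiniteField.Extension F 2 n
  obtain ⟨C, G, hC, hG⟩ := hQ.exists_isMaximallyRecoverable (ZMod 2) F (GaloisField.finrank 2 hn0)
    hr hκ hdvd hn hle
  have hK : Module.finrank F K = n := FiniteField.finrank_extension F 2 n
  let b := Module.finBasisOfFinrankEq F K hK
  exact ⟨F, K, inferInstance, Fintype.ofFinite F, inferInstance, Fintype.ofFinite K, inferInstance,
    C, G, fun t => b (Fin.castLE hκn t), hC, hG, hK.ge,
    b.linearIndependent.comp _ (Fin.castLE_injective hκn)⟩

end Existence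

end

theorem mainTheorem9 (r : ℕ) (hr : 0 < r) :
    -- some access structure has a perfect scheme with the non-trivial locality `r`
    (∃ (n : ℕ) (𝒜 : Set (Finset (Fin n))) (S T : Type) (_ : Fintype S) (_ : Nontrivial S)
      (_ : Fintype T) (f : S → PMF (Fin n → T)),
      IsPerfectScheme f 𝒜 ∧ SchemeHasLocality f r ∧ 𝒜.Nonempty ∧ ∀ A ∈ 𝒜, r < A.card) ∧
    -- the construction, with `κ = ℓ + 1`
    ∀ (n ℓ : ℕ) (Q : Fin (n / (r + 1)) → Finset (Fin n)),
      r ∣ ℓ + 1 → (r + 1) ∣ n → r < ℓ + 1 → (ℓ + 1) * (r + 1) ≤ n * r →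
      IsRepairPartition r Q →
      -- the access structure is non-empty and `r` is smaller than each of its members
      ((localAccessStructure Q r (ℓ + 1)).Nonempty ∧
        ∀ A ∈ localAccessStructure Q r (ℓ + 1), r < A.card) ∧
      -- the ingredients of the construction exist
      (∃ (F K : Type) (_ : Field F) (_ : Fintype F) (_ : Field K) (_ : Fintype K) (_ : Algebra F K)
        (C : Submodule F (Fin n → F)) (G : Matrix (Fin n) (Fin (ℓ + 1)) F) (α : Fin (ℓ + 1) → K),
        IsMaximallyRecoverable C (ℓ + 1) r Q ∧ IsGeneratorMatrix G C ∧
          n ≤ Module.finrank F K ∧ LinearIndependent F α) ∧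
      -- all such ingredients give a perfect scheme with locality `r` for the access structure
      ∀ (F K : Type*) [Field F] [Fintype F] [Field K] [Fintype K] [Algebra F K]
        (C : Submodule F (Fin n → F)) (G : Matrix (Fin n) (Fin (ℓ + 1)) F) (α : Fin (ℓ + 1) → K),
        IsMaximallyRecoverable C (ℓ + 1) r Q → IsGeneratorMatrix G C → LinearIndependent F α →
          IsPerfectScheme (gabidulinScheme G α) (localAccessStructure Q r (ℓ + 1)) ∧
            SchemeHasLocality (gabidulinScheme G α) r := by
  refine ⟨?_, ?_⟩
  · obtain ⟨Q, hQ⟩ := exists_isRepairPartition r 2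
    obtain ⟨ℓ, hℓ⟩ : ∃ ℓ, ℓ + 1 = 2 * r := ⟨2 * r - 1, by omega⟩
    have hle : (ℓ + 1) * (r + 1) ≤ 2 * (r + 1) * r := by rw [hℓ]; exact le_of_eq (by ring)
    have hn : (r + 1) ∣ 2 * (r + 1) := Dvd.intro_left 2 rfl
    obtain ⟨F, K, _, _, _, _, _, C, G, α, hC, hG, -, hα⟩ :=
      hQ.exists_ingredients hr ℓ.succ_pos (Dvd.intro_left 2 hℓ.symm) hn hle
    refine ⟨2 * (r + 1), localAccessStructure Q r (ℓ + 1), K, K, inferInstance, inferInstance,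
      inferInstance, gabidulinScheme G α, gabidulinScheme_isPerfectScheme hC hG hα,
      gabidulinScheme_schemeHasLocality hC hG α,
      ⟨_, hQ.univ_mem_localAccessStructure hn hle⟩, fun A hA => ?_⟩
    have := hQ.card_ge_of_mem_localAccessStructure hA
    omega
  · intro n ℓ Q hdvd hn hrℓ hle hQ
    exact ⟨⟨⟨_, hQ.univ_mem_localAccessStructure hn hle⟩,
        fun A hA => hrℓ.trans_le (hQ.card_ge_of_mem_localAccessStructure hA)⟩,
      hQ.exists_ingredients hr ℓ.succ_pos hdvd hn hle,
      fun F K _ _ _ _ _ C G α hC hG hα => ⟨gabidulinScheme_isPerfectScheme hC hG hα,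
        gabidulinScheme_schemeHasLocality hC hG α⟩⟩
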